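/- Let $A,B$ be finite-dimensional quantum systems with fixed bases, and let $\rho$ be a density matrix on $AB$. Put $\langle X,Y\rangle=\mathrm{Tr}(X^\dagger Y)$, let $X^{T_B}$ be the partial transpose on the second system, let $\|\cdot\|_1$ be the trace norm, and let $\mathcal R(A|B)=\{X\succeq 0:\ \|X^{T_B}\|_1\le 1\}$ be the Rains set. A completely positive trace-preserving linear map $\Lambda:AB\to A'B'$ is called Rains-preserving if $\Lambda(X)\in\mathcal R(A'|B')$ for every $X\in\mathcal R(A|B)$. For $m\in\mathbb N$, $m\ge 1$, let $\Psi_m$ be the projector onto $m^{-1/2}\sum_{i=1}^m|ii\rangle$ in $\mathbb C^m\otimes\mathbb C^m$ and define $$F(\rho,m)=\sup\{\langle\Lambda(\rho),\Psi_m\rangle:\ \Lambda \text{ Rains-preserving with } d_{A'}=d_{B'}=m\},$$ $$G^{(m)}_{\mathcal R}(\rho)=\sup\{\langle\rho,W\rangle:\ 0\preceq W\preceq \mathbb 1,\ W\in\tfrac1m\mathcal R(A|B)^\circ\},$$ where $\mathcal Q^\circ=\{X \text{ Hermitian}:\langle X,Z\rangle\le1\ \forall Z\in \mathcal Q\}$.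 For $0\le\varepsilon<1$ let $$E^{(1),\varepsilon}_d(\rho)=\log_2\max\{m\ge1:\ F(\rho,m)\ge1-\varepsilon\},$$ $$D_H^\varepsilon(\rho\|X)=-\log_2\min\{\langle M,X\rangle:\ 0\preceq M\preceq\mathbb 1,\ 1-\langle M,\rho\rangle\le\varepsilon\},$$ with $\log_2x=-\infty$ for $x\le0$, and $\lfloor x\rfloor_{\log}=\log_2\lfloor2^x\rfloor$. Theorem. For every integer $m\ge1$ both suprema above are finite and $$F(\rho,m)=G^{(m)}_{\mathcal R}(\rho).$$ For every $0\le\varepsilon<1$, the maximum defining $E^{(1),\varepsilon}_d(\rho)$ exists, the minimum $\min_{X\in\mathcal R(A|B)}D_H^\varepsilon(\rho\|X)$ is attained and finite, and $$E^{(1),\varepsilon}_d(\rho)=\Big\lfloor\min_{X\in\mathcal R(A|B)}D_H^\varepsilon(\rho\|X)\Big\rfloor_{\log}.$$ -/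

import Mathlib

open scoped Pointwise ComplexOrder Matrix

namespace RainsDistillation

noncomputable section

/-- Hilbert–Schmidt inner product `⟨X, Y⟩ = Tr (X† Y)`; it is real on Hermitian matrices, which
is where it is used, so the real part is taken. -/
def hsInner {n : Type*} [Fintype n] (X Y : Matrix n n ℂ) : ℝ :=
  ((Xᴴ * Y).trace).re

/-- Density matrices. -/
def IsState {n : Type*} [Fintype n] (ρ : Matrix n n ℂ) : Prop :=
  ρ.PosSemidef ∧ ρ.trace = 1

/-- Operators `M` with `0 ⪯ M ⪯ 1`. -/
def IsEffect {n : Type*} [DecidableEq n] (M : Matrix n n ℂ) : Prop :=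
  M.PosSemidef ∧ (1 - M).PosSemidef

/-- Schatten 1-norm `Tr |X|`, with `|X| = (X† X)^{1/2}`: the sum of the singular values of `X`. -/
def traceNorm {n : Type*} [Fintype n] [DecidableEq n] (X : Matrix n n ℂ) : ℝ :=
  ∑ i, Real.sqrt ((Matrix.isHermitian_conjTranspose_mul_self X).eigenvalues i)

/-- Partial transpose on the second subsystem. -/
def partialTranspose {A B : Type*} (X : Matrix (A × B) (A × B) ℂ) : Matrix (A × B) (A × B) ℂ :=
  Matrix.of fun p q => X (p.1, q.2) (q.1, p.2)

/-- The Rains set `{X ⪰ 0 : ‖X^{T_B}‖₁ ≤ 1}`. -/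
def rainsSet (A B : Type*) [Fintype A] [Fintype B] [DecidableEq A] [DecidableEq B] :
    Set (Matrix (A × B) (A × B) ℂ) :=
  {X | X.PosSemidef ∧ traceNorm (partialTranspose X) ≤ 1}

/-- The ampliation `id_k ⊗ Λ`, applying `Λ` to each block of a `k × k` block matrix. -/
def ampliation {n p : Type*} (k : ℕ) (Λ : Matrix n n ℂ →ₗ[ℂ] Matrix p p ℂ)
    (M : Matrix (Fin k × n) (Fin k × n) ℂ) : Matrix (Fin k × p) (Fin k × p) ℂ :=
  Matrix.of fun x y => Λ (Matrix.of fun a b => M (x.1, a) (y.1, b)) x.2 y.2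

/-- Complete positivity: every `id_k ⊗ Λ` is a positive map. -/
def IsCompletelyPositive {n p : Type*}
    (Λ : Matrix n n ℂ →ₗ[ℂ] Matrix p p ℂ) : Prop :=
  ∀ (k : ℕ) (M : Matrix (Fin k × n) (Fin k × n) ℂ), M.PosSemidef → (ampliation k Λ M).PosSemidef

/-- Completely positive trace-preserving maps. -/
def IsCPTP {n p : Type*} [Fintype n] [Fintype p]
    (Λ : Matrix n n ℂ →ₗ[ℂ] Matrix p p ℂ) : Prop :=
  IsCompletelyPositive Λ ∧ ∀ X, (Λ X).trace = X.trace

/-- The class of Rains-preserving operations `AB → A'B'`. -/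
def rainsPreserving (A B A' B' : Type*) [Fintype A] [Fintype B] [DecidableEq A] [DecidableEq B]
    [Fintype A'] [Fintype B'] [DecidableEq A'] [DecidableEq B'] :
    Set (Matrix (A × B) (A × B) ℂ →ₗ[ℂ] Matrix (A' × B') (A' × B') ℂ) :=
  {Λ | IsCPTP Λ ∧ ∀ X ∈ rainsSet A B, Λ X ∈ rainsSet A' B'}

/-- The unit vector `|Ψ_m⟩ = m^{-1/2} ∑ᵢ |ii⟩`. -/
def maxEntangledKet (m : ℕ) : Fin m × Fin m → ℂ :=
  fun p => if p.1 = p.2 then (((1 / Real.sqrt m : ℝ)) : ℂ) else 0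

/-- The projector `Ψ_m = |Ψ_m⟩⟨Ψ_m|`. -/
def maxEntangled (m : ℕ) : Matrix (Fin m × Fin m) (Fin m × Fin m) ℂ :=
  Matrix.vecMulVec (maxEntangledKet m) (star (maxEntangledKet m))

section Distillation

variable {A B : Type*} [Fintype A] [Fintype B] [DecidableEq A] [DecidableEq B]

/-- The values `⟨Λ(ρ), Ψ_m⟩` achieved by Rains-preserving operations. -/
def achievableFidelities (ρ : Matrix (A × B) (A × B) ℂ) (m : ℕ) : Set ℝ :=
  {f | ∃ Λ ∈ rainsPreserving A B (Fin m) (Fin m), f = hsInner (Λ ρ) (maxEntangled m)}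

/-- The fidelity of distillation `F(ρ, m)` under Rains-preserving operations. -/
def distillationFidelity (ρ : Matrix (A × B) (A × B) ℂ) (m : ℕ) : ℝ :=
  sSup (achievableFidelities ρ m)

/-- The sizes `m ≥ 1` for which `Ψ_m` can be distilled with error at most `ε`. -/
def distillableSizes (ρ : Matrix (A × B) (A × B) ℂ) (ε : ℝ) : Set ℕ :=
  {m | 0 < m ∧ 1 - ε ≤ distillationFidelity ρ m}

/-- The one-shot `ε`-error distillable entanglement under Rains-preserving operations. -/
def oneShotDistillable (ρ : Matrix (A × B) (A × B) ℂ) (ε : ℝ) : ℝ :=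
  Real.logb 2 ((sSup (distillableSizes ρ ε) : ℕ) : ℝ)

end Distillation

/-- The polar `Q° = {X : ⟨X, Z⟩ ≤ 1 for all Z ∈ Q}` within the Hermitian matrices. -/
def polar {n : Type*} [Fintype n] (Q : Set (Matrix n n ℂ)) : Set (Matrix n n ℂ) :=
  {X | X.IsHermitian ∧ ∀ Z ∈ Q, hsInner X Z ≤ 1}

/-- The values `⟨ρ, W⟩` with `0 ⪯ W ⪯ 1` and `W ∈ (1/m) Q°`. -/
def gValues {n : Type*} [Fintype n] [DecidableEq n] (Q : Set (Matrix n n ℂ)) (m : ℝ)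
    (ρ : Matrix n n ℂ) : Set ℝ :=
  {g | ∃ W, IsEffect W ∧ W ∈ (1 / m) • polar Q ∧ g = hsInner ρ W}

/-- The quantity `G^{(m)}_Q(ρ)`. -/
def gQuantity {n : Type*} [Fintype n] [DecidableEq n] (Q : Set (Matrix n n ℂ)) (m : ℝ)
    (ρ : Matrix n n ℂ) : ℝ :=
  sSup (gValues Q m ρ)

/-- Binary logarithm with values in the extended reals and `log x = -∞` for `x ≤ 0`. -/
def elog2 (x : ℝ) : EReal :=
  if x ≤ 0 then ⊥ else ((Real.logb 2 x : ℝ) : EReal)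

/-- The hypothesis testing relative entropy
`D_H^ε(ρ‖X) = -log min {⟨M, X⟩ : 0 ⪯ M ⪯ 1, 1 - ⟨M, ρ⟩ ≤ ε}`. -/
def hypothesisTestingEntropy {n : Type*} [Fintype n] [DecidableEq n] (ε : ℝ)
    (ρ X : Matrix n n ℂ) : EReal :=
  -elog2 (sInf {t | ∃ M, IsEffect M ∧ 1 - hsInner M ρ ≤ ε ∧ t = hsInner M X})

/-- `⌊x⌋_log = log ⌊2^x⌋`, with logarithm in base 2. -/
def logFloor (x : ℝ) : ℝ :=
  Real.logb 2 ((⌊(2 : ℝ) ^ x⌋ : ℤ) : ℝ)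

end

end RainsDistillation

open RainsDistillation

/-!
Upper bound: the adjoint of a Rains-preserving channel sends `Ψ_m` to an effect `W`. Since
`Ψ_m^{T_B}` is the swap operator divided by `m`, and the swap lies between `-1` and `1`, `Ψ_m` has
overlap at most `1/m` with the Rains set, so `W` is feasible for `G^{(m)}`.

Lower bound: given a feasible `W`, measure it and prepare `Ψ_m` or the normalized complement of
`Ψ_m`. The partial transposes of these isotropic outputs lie in the span of `1` and the swap, where
the trace norm is explicit, and `⟨W, X⟩ ≤ 1/m` is exactly what keeps it at most one.

One-shot part: Sion's theorem gives a saddle value `v` of `⟨M, X⟩` for tests `M` against elements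
`X` of the Rains set. A size `m` is distillable if and only if `m v ≤ 1`, so the largest size is
`⌊1/v⌋`, while the least hypothesis testing entropy is `-log₂ v`.
-/

namespace RainsDistillation

section PosSemidef

open scoped MatrixOrder Matrix.Norms.L2Operator

variable {n : Type*} [Fintype n]

theorem trace_mul_nonneg {P Q : Matrix n n ℂ} (hP : P.PosSemidef) (hQ : Q.PosSemidef) :
    0 ≤ (P * Q).trace := by
  classical
  obtain ⟨B, rfl⟩ := CStarAlgebra.nonneg_iff_eq_star_mul_self.1 hP.nonneg
  rw [Matrix.mul_assoc, Matrix.trace_mul_comm]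
  exact (hQ.mul_mul_conjTranspose_same B).trace_nonneg

theorem re_trace_mul_nonneg {P Q : Matrix n n ℂ} (hP : P.PosSemidef) (hQ : Q.PosSemidef) :
    0 ≤ (P * Q).trace.re :=
  (Complex.le_def.1 (trace_mul_nonneg hP hQ)).1

theorem posSemidef_of_trace_mul_nonneg {W : Matrix n n ℂ}
    (h : ∀ X : Matrix n n ℂ, X.PosSemidef → 0 ≤ (W * X).trace) : W.PosSemidef := by
  classical
  rw [← Matrix.isPositive_toEuclideanLin_iff, LinearMap.isPositive_iff_complex]
  intro x
  have hinner : inner ℂ (W.toEuclideanLin x) x =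
      star (W * Matrix.vecMulVec x.ofLp (star x.ofLp)).trace := by
    rw [Matrix.mul_vecMulVec, Matrix.trace_vecMulVec, EuclideanSpace.inner_eq_star_dotProduct,
      ← Matrix.star_dotProduct_star, star_star]
    rfl
  have hnonneg := h _ (Matrix.posSemidef_vecMulVec_self_star x.ofLp)
  obtain ⟨r, hr, hrx⟩ := RCLike.nonneg_iff_exists_ofReal.1 hnonneg
  simpa [hinner, ← hrx] using hr

end PosSemidef

section Effects

open scoped MatrixOrder Matrix.Norms.L2Operator

variable {n : Type*} [DecidableEq n]

theorem isEffect_iff_mem_Icc {M : Matrix n n ℂ} : IsEffect M ↔ M ∈ Set.Icc 0 1 := by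
  rw [Set.mem_Icc, Matrix.nonneg_iff_posSemidef, Matrix.le_iff, IsEffect]

theorem setOf_isEffect_eq_Icc : {M : Matrix n n ℂ | IsEffect M} = Set.Icc 0 1 :=
  Set.ext fun _ => isEffect_iff_mem_Icc

theorem isEffect_one : IsEffect (1 : Matrix n n ℂ) :=
  ⟨.one, by rw [sub_self]; exact .zero⟩

theorem isEffect_zero : IsEffect (0 : Matrix n n ℂ) :=
  ⟨.zero, by rw [sub_zero]; exact .one⟩

theorem convex_setOf_isEffect : Convex ℝ {M : Matrix n n ℂ | IsEffect M} := by
  intro M hM N hN a b ha hb hab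
  refine ⟨(hM.1.smul ha).add (hN.1.smul hb), ?_⟩
  have hcompl : 1 - (a • M + b • N) = a • (1 - M) + b • (1 - N) := by
    obtain rfl := eq_sub_of_add_eq hab
    module
  rw [hcompl]
  exact (hM.2.smul ha).add (hN.2.smul hb)

theorem isCompact_setOf_isEffect [Finite n] : IsCompact {M : Matrix n n ℂ | IsEffect M} := by
  cases nonempty_fintype n
  have : ProperSpace (Matrix n n ℂ) := FiniteDimensional.proper ℂ _
  rw [setOf_isEffect_eq_Icc]
  refine Metric.isCompact_of_isClosed_isBounded isClosed_Icc
    ((Metric.isBounded_closedBall (x := 0) (r := 1)).subset fun M hM => ?_)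
  rw [mem_closedBall_zero_iff]
  exact (CStarAlgebra.norm_le_one_iff_of_nonneg M hM.1).2 hM.2

theorem isEffect_of_re_trace_le_one [Fintype n] {X : Matrix n n ℂ} (hX : X.PosSemidef)
    (htr : X.trace.re ≤ 1) : IsEffect X := by
  refine isEffect_iff_mem_Icc.2 ⟨hX.nonneg, ?_⟩
  rw [← map_one (algebraMap ℝ (Matrix n n ℂ)), le_algebraMap_iff_spectrum_le (ha := hX.1),
    hX.1.spectrum_real_eq_range_eigenvalues]
  rintro _ ⟨i, rfl⟩
  rw [hX.1.trace_eq_sum_eigenvalues, ← RCLike.ofReal_sum] at htr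
  exact (Finset.single_le_sum (fun j _ => hX.eigenvalues_nonneg j) (Finset.mem_univ i)).trans htr

end Effects

section TraceNorm

open scoped MatrixOrder Matrix.Norms.L2Operator

variable {n : Type*} [Fintype n] [DecidableEq n]

theorem traceNorm_eq_re_trace_abs (X : Matrix n n ℂ) : traceNorm X = (CFC.abs X).trace.re := by
  have hX := Matrix.isHermitian_conjTranspose_mul_self X
  have habs : CFC.abs X = hX.cfc Real.sqrt := by
    rw [CFC.abs, Matrix.star_eq_conjTranspose,
      CFC.sqrt_eq_real_sqrt _ (Matrix.posSemidef_conjTranspose_mul_self X).nonneg, cfcₙ_eq_cfc,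
      hX.cfc_eq]
  rw [habs, Matrix.IsHermitian.cfc, Unitary.conjStarAlgAut_apply, Matrix.trace_mul_cycle,
    Unitary.coe_star_mul_self, one_mul, Matrix.trace_diagonal, traceNorm]
  simp

theorem traceNorm_nonneg (X : Matrix n n ℂ) : 0 ≤ traceNorm X :=
  Finset.sum_nonneg fun _ _ => Real.sqrt_nonneg _

theorem traceNorm_of_posSemidef {X : Matrix n n ℂ} (hX : X.PosSemidef) :
    traceNorm X = X.trace.re := by
  rw [traceNorm_eq_re_trace_abs, CFC.abs_of_nonneg X hX.nonneg]

theorem traceNorm_smul (c : ℝ) (X : Matrix n n ℂ) : traceNorm (c • X) = |c| * traceNorm X := by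
  simp [traceNorm_eq_re_trace_abs, CFC.abs_smul]

theorem continuous_traceNorm : Continuous (traceNorm : Matrix n n ℂ → ℝ) := by
  have habs := CFC.continuous_abs (A := Matrix n n ℂ)
  rw [funext traceNorm_eq_re_trace_abs]
  fun_prop

theorem exists_mul_eq_abs {H : Matrix n n ℂ} (hH : H.IsHermitian) :
    ∃ C : Matrix n n ℂ, -1 ≤ C ∧ C ≤ 1 ∧ C * H = CFC.abs H := by
  have hsa : IsSelfAdjoint H := hH
  let sgn : ℝ → ℝ := fun x => SignType.sign x
  have hcont : ContinuousOn sgn (spectrum ℝ H) := Matrix.finite_real_spectrum.continuousOn _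
  refine ⟨cfc sgn H, ?_, ?_, ?_⟩
  · rw [← map_one (algebraMap ℝ (Matrix n n ℂ)), ← map_neg, algebraMap_le_cfc_iff ..]
    intro x _
    rcases lt_trichotomy x 0 with h | h | h <;> simp [sgn, h]
  · refine cfc_le_one _ _ fun x _ => ?_
    rcases lt_trichotomy x 0 with h | h | h <;> simp [sgn, h]
  · rw [CFC.abs_eq_cfc_norm H hsa]
    nth_rw 2 [← cfc_id' ℝ H]
    rw [← cfc_mul ..]
    simp [sgn]

theorem re_trace_mul_sub_le {C P N : Matrix n n ℂ} (hC : -1 ≤ C) (hC' : C ≤ 1)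
    (hP : P.PosSemidef) (hN : N.PosSemidef) :
    (C * (P - N)).trace.re ≤ P.trace.re + N.trace.re := by
  have h₁ := re_trace_mul_nonneg (Matrix.le_iff.1 hC') hP
  have h₂ := re_trace_mul_nonneg (Matrix.le_iff.1 hC) hN
  simp only [sub_neg_eq_add, Matrix.sub_mul, Matrix.add_mul, Matrix.mul_sub, one_mul,
    Matrix.trace_sub, Matrix.trace_add, Complex.sub_re, Complex.add_re] at h₁ h₂ ⊢
  linarith

theorem exists_posSemidef_sub_eq {H : Matrix n n ℂ} (hH : H.IsHermitian) :
    ∃ P N : Matrix n n ℂ, P.PosSemidef ∧ N.PosSemidef ∧ H = P - N ∧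
      traceNorm H = P.trace.re + N.trace.re := by
  refine ⟨H⁺, H⁻, Matrix.nonneg_iff_posSemidef.1 (CFC.posPart_nonneg H),
    Matrix.nonneg_iff_posSemidef.1 (CFC.negPart_nonneg H), (CFC.posPart_sub_negPart H hH).symm, ?_⟩
  rw [traceNorm_eq_re_trace_abs, ← CFC.posPart_add_negPart H hH, Matrix.trace_add, Complex.add_re]

theorem re_trace_mul_le_traceNorm {C H : Matrix n n ℂ} (hC : -1 ≤ C) (hC' : C ≤ 1)
    (hH : H.IsHermitian) : (C * H).trace.re ≤ traceNorm H := by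
  obtain ⟨P, N, hP, hN, rfl, hnorm⟩ := exists_posSemidef_sub_eq hH
  exact (re_trace_mul_sub_le hC hC' hP hN).trans_eq hnorm.symm

theorem traceNorm_add_le {H K : Matrix n n ℂ} (hH : H.IsHermitian) (hK : K.IsHermitian) :
    traceNorm (H + K) ≤ traceNorm H + traceNorm K := by
  obtain ⟨C, hC, hC', habs⟩ := exists_mul_eq_abs (hH.add hK)
  rw [traceNorm_eq_re_trace_abs, ← habs, Matrix.mul_add, Matrix.trace_add, Complex.add_re]
  exact add_le_add (re_trace_mul_le_traceNorm hC hC' hH) (re_trace_mul_le_traceNorm hC hC' hK)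

end TraceNorm

section HilbertSchmidt

variable {n : Type*} [Fintype n]

theorem hsInner_of_isHermitian {X : Matrix n n ℂ} (hX : X.IsHermitian) (Y : Matrix n n ℂ) :
    hsInner X Y = (X * Y).trace.re := by
  rw [hsInner, hX.eq]

theorem hsInner_comm (X Y : Matrix n n ℂ) : hsInner X Y = hsInner Y X := by
  rw [hsInner, hsInner, ← Complex.conj_re, starRingEnd_apply, ← Matrix.trace_conjTranspose,
    Matrix.conjTranspose_mul, Matrix.conjTranspose_conjTranspose]

theorem isLinearMap_hsInner (X : Matrix n n ℂ) : IsLinearMap ℝ (hsInner X) where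
  map_add Y Z := by simp [hsInner, Matrix.mul_add]
  map_smul c Y := by simp [hsInner]

theorem hsInner_smul_left (c : ℝ) (X Y : Matrix n n ℂ) : hsInner (c • X) Y = c * hsInner X Y := by
  rw [hsInner_comm, (isLinearMap_hsInner Y).map_smul, hsInner_comm, smul_eq_mul]

theorem hsInner_sub_left (X Y Z : Matrix n n ℂ) :
    hsInner (X - Y) Z = hsInner X Z - hsInner Y Z := by
  simp only [hsInner_comm _ Z, (isLinearMap_hsInner Z).map_sub]

theorem hsInner_one_left [DecidableEq n] (X : Matrix n n ℂ) : hsInner 1 X = X.trace.re := by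
  simp [hsInner]

theorem continuous_hsInner (X : Matrix n n ℂ) : Continuous (hsInner X) := by
  unfold hsInner
  fun_prop

theorem hsInner_nonneg {X Y : Matrix n n ℂ} (hX : X.PosSemidef) (hY : Y.PosSemidef) :
    0 ≤ hsInner X Y := by
  rw [hsInner_of_isHermitian hX.1]
  exact re_trace_mul_nonneg hX hY

theorem trace_mul_eq_ofReal_hsInner {W X : Matrix n n ℂ} (hW : W.PosSemidef)
    (hX : X.PosSemidef) : (W * X).trace = (hsInner W X : ℂ) := by
  rw [hsInner_of_isHermitian hW.1]
  exact Complex.ext rfl (Complex.le_def.1 (trace_mul_nonneg hW hX)).2.symm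

theorem IsEffect.hsInner_le_re_trace [DecidableEq n] {M X : Matrix n n ℂ} (hM : IsEffect M)
    (hX : X.PosSemidef) : hsInner M X ≤ X.trace.re := by
  have hcompl := hsInner_nonneg hM.2 hX
  rwa [hsInner_sub_left, hsInner_one_left, sub_nonneg] at hcompl

end HilbertSchmidt

section PartialTranspose

variable {A B : Type*}

theorem partialTranspose_apply (X : Matrix (A × B) (A × B) ℂ) (p q : A × B) :
    partialTranspose X p q = X (p.1, q.2) (q.1, p.2) := rfl

theorem isLinearMap_partialTranspose :
    IsLinearMap ℝ (partialTranspose : Matrix (A × B) (A × B) ℂ → _) where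
  map_add _ _ := rfl
  map_smul _ _ := rfl

theorem isHermitian_partialTranspose {X : Matrix (A × B) (A × B) ℂ} (hX : X.IsHermitian) :
    (partialTranspose X).IsHermitian :=
  Matrix.IsHermitian.ext fun _ _ => hX.apply _ _

theorem continuous_partialTranspose :
    Continuous (partialTranspose : Matrix (A × B) (A × B) ℂ → _) :=
  continuous_matrix fun _ _ => continuous_id.matrix_elem _ _

theorem partialTranspose_one [DecidableEq A] [DecidableEq B] :
    partialTranspose (1 : Matrix (A × B) (A × B) ℂ) = 1 := by
  ext ⟨a, b⟩ ⟨c, d⟩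
  simp [partialTranspose_apply, Matrix.one_apply, eq_comm]

theorem partialTranspose_of_subsingleton [Subsingleton B] (X : Matrix (A × B) (A × B) ℂ) :
    partialTranspose X = X := by
  ext ⟨a, b⟩ ⟨c, d⟩
  rw [partialTranspose_apply, Subsingleton.elim b d]

variable [Fintype A] [Fintype B]

theorem trace_partialTranspose (X : Matrix (A × B) (A × B) ℂ) :
    (partialTranspose X).trace = X.trace := rfl

theorem trace_partialTranspose_mul_partialTranspose (X Y : Matrix (A × B) (A × B) ℂ) :
    (partialTranspose X * partialTranspose Y).trace = (X * Y).trace := by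
  simp only [Matrix.trace, Matrix.diag_apply, Matrix.mul_apply, partialTranspose_apply,
    Fintype.sum_prod_type]
  refine Finset.sum_congr rfl fun a _ => ?_
  rw [Finset.sum_comm, Finset.sum_comm (s := Finset.univ (α := B))]
  refine Finset.sum_congr rfl fun c _ => Finset.sum_comm

end PartialTranspose

section RainsSet

open scoped MatrixOrder

variable {A B : Type*} [Fintype A] [Fintype B] [DecidableEq A] [DecidableEq B]

theorem re_trace_le_one_of_mem_rainsSet {X : Matrix (A × B) (A × B) ℂ} (hX : X ∈ rainsSet A B) :
    X.trace.re ≤ 1 := by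
  have hone : (-1 : Matrix (A × B) (A × B) ℂ) ≤ 1 := neg_le_self zero_le_one
  simpa [trace_partialTranspose] using
    (re_trace_mul_le_traceNorm hone le_rfl (isHermitian_partialTranspose hX.1.1)).trans hX.2

theorem zero_mem_rainsSet : (0 : Matrix (A × B) (A × B) ℂ) ∈ rainsSet A B := by
  refine ⟨.zero, ?_⟩
  rw [isLinearMap_partialTranspose.map_zero, traceNorm_of_posSemidef .zero]
  simp

theorem isCompact_rainsSet : IsCompact (rainsSet A B) := by
  have heq : rainsSet A B = {X | IsEffect X} ∩ {X | traceNorm (partialTranspose X) ≤ 1} :=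
    Set.Subset.antisymm
      (fun X hX => ⟨isEffect_of_re_trace_le_one hX.1 (re_trace_le_one_of_mem_rainsSet hX), hX.2⟩)
      fun X hX => ⟨hX.1.1, hX.2⟩
  rw [heq]
  exact isCompact_setOf_isEffect.inter_right
    (isClosed_le (continuous_traceNorm.comp continuous_partialTranspose) continuous_const)

theorem convex_rainsSet : Convex ℝ (rainsSet A B) := by
  intro X hX Y hY a b ha hb hab
  refine ⟨(hX.1.smul ha).add (hY.1.smul hb), ?_⟩
  have hX' := isHermitian_partialTranspose hX.1.1
  have hY' := isHermitian_partialTranspose hY.1.1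
  calc traceNorm (partialTranspose (a • X + b • Y))
      = traceNorm (a • partialTranspose X + b • partialTranspose Y) := rfl
    _ ≤ traceNorm (a • partialTranspose X) + traceNorm (b • partialTranspose Y) :=
        traceNorm_add_le (hX'.smul (.all a)) (hY'.smul (.all b))
    _ = a * traceNorm (partialTranspose X) + b * traceNorm (partialTranspose Y) := by
        rw [traceNorm_smul, traceNorm_smul, abs_of_nonneg ha, abs_of_nonneg hb]
    _ ≤ a * 1 + b * 1 := by gcongr; exacts [hX.2, hY.2]
    _ = 1 := by rw [mul_one, mul_one, hab]

theorem exists_pos_smul_mem_rainsSet {X : Matrix (A × B) (A × B) ℂ} (hX : X.PosSemidef) :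
    ∃ c : ℝ, 0 < c ∧ c • X ∈ rainsSet A B := by
  have hpos : 0 < 1 + traceNorm (partialTranspose X) :=
    add_pos_of_pos_of_nonneg one_pos (traceNorm_nonneg _)
  refine ⟨(1 + traceNorm (partialTranspose X))⁻¹, inv_pos.2 hpos, hX.smul (inv_pos.2 hpos).le, ?_⟩
  rw [isLinearMap_partialTranspose.map_smul, traceNorm_smul, abs_of_pos (inv_pos.2 hpos),
    inv_mul_le_iff₀ hpos]
  linarith

end RainsSet

section TraceAdjoint

variable {n p : Type*} [DecidableEq n] [Fintype p]

/-- The adjoint of `Λ` for the bilinear form `Tr (XY)`, given by its entries; on Hermitian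
matrices it is also the adjoint for the Hilbert–Schmidt inner product. -/
def traceAdjoint (Λ : Matrix n n ℂ →ₗ[ℂ] Matrix p p ℂ) (Q : Matrix p p ℂ) : Matrix n n ℂ :=
  Matrix.of fun a b => (Q * Λ (Matrix.single b a 1)).trace

variable [Fintype n] {Λ : Matrix n n ℂ →ₗ[ℂ] Matrix p p ℂ}

theorem trace_traceAdjoint_mul (Q : Matrix p p ℂ) (X : Matrix n n ℂ) :
    (traceAdjoint Λ Q * X).trace = (Q * Λ X).trace := by
  have hX : X = ∑ b, ∑ a, X b a • Matrix.single b a (1 : ℂ) := by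
    simpa using Matrix.matrix_eq_sum_single X
  calc (traceAdjoint Λ Q * X).trace
      = ∑ a, ∑ b, (Q * Λ (Matrix.single b a 1)).trace * X b a := by
        simp [traceAdjoint, Matrix.trace, Matrix.mul_apply]
    _ = ∑ b, ∑ a, X b a * (Q * Λ (Matrix.single b a 1)).trace := by
        rw [Finset.sum_comm]; simp only [mul_comm]
    _ = (Q * Λ X).trace := by
        conv_rhs => rw [hX]
        simp only [map_sum, map_smul, Matrix.mul_sum, Matrix.mul_smul, Matrix.trace_sum,
          Matrix.trace_smul, smul_eq_mul]

theorem isEffect_traceAdjoint [DecidableEq p]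
    (hpos : ∀ X : Matrix n n ℂ, X.PosSemidef → (Λ X).PosSemidef)
    (htr : ∀ X, (Λ X).trace = X.trace) {Q : Matrix p p ℂ} (hQ : IsEffect Q) :
    IsEffect (traceAdjoint Λ Q) := by
  refine ⟨posSemidef_of_trace_mul_nonneg fun X hX => ?_,
    posSemidef_of_trace_mul_nonneg fun X hX => ?_⟩
  · rw [trace_traceAdjoint_mul]
    exact trace_mul_nonneg hQ.1 (hpos X hX)
  · have hcompl : ((1 - traceAdjoint Λ Q) * X).trace = ((1 - Q) * Λ X).trace := by
      rw [Matrix.sub_mul, Matrix.sub_mul, Matrix.trace_sub, Matrix.trace_sub, one_mul, one_mul,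
        trace_traceAdjoint_mul, htr]
    rw [hcompl]
    exact trace_mul_nonneg hQ.2 (hpos X hX)

theorem hsInner_traceAdjoint [DecidableEq p]
    (hpos : ∀ X : Matrix n n ℂ, X.PosSemidef → (Λ X).PosSemidef)
    (htr : ∀ X, (Λ X).trace = X.trace) {Q : Matrix p p ℂ} (hQ : IsEffect Q) (X : Matrix n n ℂ) :
    hsInner (traceAdjoint Λ Q) X = hsInner Q (Λ X) := by
  rw [hsInner_of_isHermitian (isEffect_traceAdjoint hpos htr hQ).1.1,
    hsInner_of_isHermitian hQ.1.1, trace_traceAdjoint_mul]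

end TraceAdjoint

section MeasurePrepare

variable {n p : Type*}

theorem IsCompletelyPositive.posSemidef_apply {Λ : Matrix n n ℂ →ₗ[ℂ] Matrix p p ℂ}
    (hΛ : IsCompletelyPositive Λ) {X : Matrix n n ℂ} (hX : X.PosSemidef) : (Λ X).PosSemidef :=
  (hΛ 1 (X.submatrix Prod.snd Prod.snd) (hX.submatrix _)).submatrix fun a => (0, a)

theorem IsCompletelyPositive.add {Λ Γ : Matrix n n ℂ →ₗ[ℂ] Matrix p p ℂ}
    (hΛ : IsCompletelyPositive Λ) (hΓ : IsCompletelyPositive Γ) : IsCompletelyPositive (Λ + Γ) :=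
  fun k M hM => (hΛ k M hM).add (hΓ k M hM)

variable [Fintype n]

open scoped MatrixOrder Matrix.Norms.L2Operator in
theorem posSemidef_of_trace_mul_block {κ : Type*} [Finite κ] {W : Matrix n n ℂ}
    (hW : W.PosSemidef) {M : Matrix (κ × n) (κ × n) ℂ} (hM : M.PosSemidef) :
    (Matrix.of fun x y => (W * Matrix.of fun a b => M (x, a) (y, b)).trace).PosSemidef := by
  classical
  cases nonempty_fintype κ
  obtain ⟨B, rfl⟩ := CStarAlgebra.nonneg_iff_eq_star_mul_self.1 hW.nonneg
  let V : n → Matrix κ (κ × n) ℂ := fun c => Matrix.of fun x y => if x = y.1 then B c y.2 else 0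
  have hsum : (Matrix.of fun x y => (star B * B * Matrix.of fun a b => M (x, a) (y, b)).trace) =
      ∑ c, V c * M * (V c)ᴴ := by
    ext x y
    rw [Matrix.of_apply, Matrix.mul_assoc, Matrix.trace_mul_comm, Matrix.sum_apply, Matrix.trace]
    refine Finset.sum_congr rfl fun c _ => ?_
    simp [V, Matrix.mul_apply, Fintype.sum_prod_type, apply_ite, ite_mul, Finset.sum_ite_irrel]
  rw [hsum]
  exact Matrix.posSemidef_sum _ fun c _ => hM.mul_mul_conjTranspose_same _

/-- The map `X ↦ Tr (W X) P`: prepare `P` upon the outcome `W` of a measurement. -/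
def traceSMul (W : Matrix n n ℂ) (P : Matrix p p ℂ) : Matrix n n ℂ →ₗ[ℂ] Matrix p p ℂ where
  toFun X := (W * X).trace • P
  map_add' X Y := by simp only [Matrix.mul_add, Matrix.trace_add, add_smul]
  map_smul' c X := by
    simp only [Matrix.mul_smul, Matrix.trace_smul, smul_assoc, RingHom.id_apply]

theorem isCompletelyPositive_traceSMul [Finite p] {W : Matrix n n ℂ} {P : Matrix p p ℂ}
    (hW : W.PosSemidef) (hP : P.PosSemidef) : IsCompletelyPositive (traceSMul W P) :=
  fun _ _ hM => (posSemidef_of_trace_mul_block hW hM).kronecker hP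

variable [DecidableEq n]

/-- The channel which measures the effect `W` and prepares `P` or `Q` according to the outcome. -/
def measurePrepare (W : Matrix n n ℂ) (P Q : Matrix p p ℂ) : Matrix n n ℂ →ₗ[ℂ] Matrix p p ℂ :=
  traceSMul W P + traceSMul (1 - W) Q

theorem isCPTP_measurePrepare [Fintype p] {W : Matrix n n ℂ} {P Q : Matrix p p ℂ}
    (hW : IsEffect W) (hP : IsState P) (hQ : IsState Q) : IsCPTP (measurePrepare W P Q) := by
  refine ⟨(isCompletelyPositive_traceSMul hW.1 hP.1).add
    (isCompletelyPositive_traceSMul hW.2 hQ.1), fun X => ?_⟩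
  calc (measurePrepare W P Q X).trace
      = (W * X).trace * P.trace + ((1 - W) * X).trace * Q.trace := by
        simp only [measurePrepare, traceSMul, LinearMap.add_apply, LinearMap.coe_mk,
          AddHom.coe_mk, Matrix.trace_add, Matrix.trace_smul, smul_eq_mul]
    _ = X.trace := by
        rw [hP.2, hQ.2, mul_one, mul_one, ← Matrix.trace_add, ← Matrix.add_mul,
          add_sub_cancel, one_mul]

theorem measurePrepare_apply_of_posSemidef {W X : Matrix n n ℂ} (hW : IsEffect W)
    (hX : X.PosSemidef) (P Q : Matrix p p ℂ) :
    measurePrepare W P Q X = hsInner W X • P + hsInner (1 - W) X • Q := by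
  simp only [measurePrepare, traceSMul, LinearMap.add_apply, LinearMap.coe_mk, AddHom.coe_mk,
    trace_mul_eq_ofReal_hsInner hW.1 hX, trace_mul_eq_ofReal_hsInner hW.2 hX, Complex.coe_smul]

end MeasurePrepare

section Swap

open scoped MatrixOrder Matrix.Norms.L2Operator

variable (ι : Type*) [DecidableEq ι]

/-- The operator exchanging the two tensor factors of `ℂ^ι ⊗ ℂ^ι`. -/
def swapMatrix : Matrix (ι × ι) (ι × ι) ℂ :=
  Equiv.Perm.permMatrix ℂ (Equiv.prodComm ι ι)

variable {ι} in
theorem swapMatrix_apply (p q : ι × ι) : swapMatrix ι p q = if p.swap = q then 1 else 0 := by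
  simp [swapMatrix, PEquiv.toMatrix_apply, eq_comm]

theorem isHermitian_swapMatrix : (swapMatrix ι).IsHermitian :=
  Matrix.conjTranspose_permMatrix _

theorem swapMatrix_mem_Icc [Finite ι] : swapMatrix ι ∈ Set.Icc (-1) 1 := by
  cases nonempty_fintype ι
  have hsa : IsSelfAdjoint (swapMatrix ι) := isHermitian_swapMatrix ι
  have hnorm : algebraMap ℝ (Matrix (ι × ι) (ι × ι) ℂ) ‖swapMatrix ι‖ ≤ 1 := by
    rw [← map_one (algebraMap ℝ (Matrix (ι × ι) (ι × ι) ℂ))]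
    exact algebraMap_mono _ (Matrix.permMatrix_l2_opNorm_le _)
  exact ⟨(neg_le_neg hnorm).trans hsa.neg_algebraMap_norm_le_self,
    hsa.le_algebraMap_norm_self.trans hnorm⟩

variable [Fintype ι]

theorem trace_swapMatrix : (swapMatrix ι).trace = Fintype.card ι := by
  have hfix (a b : ι) : (a, b).swap = (a, b) ↔ a = b :=
    ⟨fun h => (Prod.ext_iff.1 h).2, fun h => h ▸ rfl⟩
  simp only [Matrix.trace, Matrix.diag_apply, swapMatrix_apply, Fintype.sum_prod_type, hfix]
  simp

theorem traceNorm_smul_one_add_smul_swapMatrix_le (α β : ℝ) :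
    traceNorm (α • (1 : Matrix (ι × ι) (ι × ι) ℂ) + β • swapMatrix ι) ≤
      |α + β| * ((Fintype.card ι ^ 2 + Fintype.card ι) / 2) +
        |α - β| * ((Fintype.card ι ^ 2 - Fintype.card ι) / 2) := by
  have hanti : (1 - swapMatrix ι).PosSemidef := Matrix.le_iff.1 (swapMatrix_mem_Icc ι).2
  have hsym : (1 + swapMatrix ι).PosSemidef := by
    simpa only [sub_neg_eq_add, add_comm] using Matrix.le_iff.1 (swapMatrix_mem_Icc ι).1
  have hdecomp : α • (1 : Matrix (ι × ι) (ι × ι) ℂ) + β • swapMatrix ι =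
      ((α + β) / 2) • (1 + swapMatrix ι) + ((α - β) / 2) • (1 - swapMatrix ι) := by module
  have htrace_sym : (1 + swapMatrix ι).trace.re = Fintype.card ι ^ 2 + Fintype.card ι := by
    simp [trace_swapMatrix, sq]
  have htrace_anti : (1 - swapMatrix ι).trace.re = Fintype.card ι ^ 2 - Fintype.card ι := by
    simp [trace_swapMatrix, sq]
  calc traceNorm (α • (1 : Matrix (ι × ι) (ι × ι) ℂ) + β • swapMatrix ι)
      ≤ traceNorm (((α + β) / 2) • (1 + swapMatrix ι)) +
          traceNorm (((α - β) / 2) • (1 - swapMatrix ι)) := by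
        rw [hdecomp]
        exact traceNorm_add_le (hsym.1.smul (.all _)) (hanti.1.smul (.all _))
    _ = |α + β| * ((Fintype.card ι ^ 2 + Fintype.card ι) / 2) +
          |α - β| * ((Fintype.card ι ^ 2 - Fintype.card ι) / 2) := by
        rw [traceNorm_smul, traceNorm_smul, traceNorm_of_posSemidef hsym,
          traceNorm_of_posSemidef hanti, htrace_sym, htrace_anti, abs_div, abs_div, abs_two]
        ring

end Swap

section MaxEntangled

open scoped MatrixOrder

theorem maxEntangled_apply (m : ℕ) (p q : Fin m × Fin m) :
    maxEntangled m p q = if p.1 = p.2 ∧ q.1 = q.2 then (m : ℂ)⁻¹ else 0 := by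
  have hsqrt : ((Real.sqrt m : ℂ))⁻¹ * (Real.sqrt m : ℂ)⁻¹ = (m : ℂ)⁻¹ := by
    rw [← mul_inv, ← Complex.ofReal_mul, Real.mul_self_sqrt (Nat.cast_nonneg m),
      Complex.ofReal_natCast]
  simp only [maxEntangled, maxEntangledKet, Matrix.vecMulVec_apply, Pi.star_apply]
  by_cases hp : p.1 = p.2 <;> by_cases hq : q.1 = q.2 <;> simp [hp, hq, hsqrt]

theorem partialTranspose_maxEntangled (m : ℕ) :
    partialTranspose (maxEntangled m) = (m : ℝ)⁻¹ • swapMatrix (Fin m) := by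
  ext ⟨a, b⟩ ⟨c, d⟩
  simp [partialTranspose_apply, maxEntangled_apply, swapMatrix_apply, and_comm, eq_comm (a := c)]

theorem trace_maxEntangled {m : ℕ} (hm : 0 < m) : (maxEntangled m).trace = 1 := by
  have hm' : (m : ℂ) ≠ 0 := Nat.cast_ne_zero.2 hm.ne'
  rw [← trace_partialTranspose, partialTranspose_maxEntangled, Matrix.trace_smul,
    trace_swapMatrix, Fintype.card_fin]
  simp [hm']

theorem posSemidef_maxEntangled (m : ℕ) : (maxEntangled m).PosSemidef :=
  Matrix.posSemidef_vecMulVec_self_star _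

theorem isState_maxEntangled {m : ℕ} (hm : 0 < m) : IsState (maxEntangled m) :=
  ⟨posSemidef_maxEntangled m, trace_maxEntangled hm⟩

theorem isEffect_maxEntangled {m : ℕ} (hm : 0 < m) : IsEffect (maxEntangled m) :=
  isEffect_of_re_trace_le_one (posSemidef_maxEntangled m) (by simp [trace_maxEntangled hm])

theorem hsInner_maxEntangled_self {m : ℕ} (hm : 0 < m) :
    hsInner (maxEntangled m) (maxEntangled m) = 1 := by
  have hunit := trace_maxEntangled hm
  have hproj : maxEntangled m * maxEntangled m = maxEntangled m := by
    rw [maxEntangled, Matrix.trace_vecMulVec, dotProduct_comm] at hunit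
    rw [maxEntangled, Matrix.vecMulVec_mul_vecMulVec, hunit, one_smul]
  rw [hsInner_of_isHermitian (posSemidef_maxEntangled m).1, hproj, hunit, Complex.one_re]

theorem hsInner_maxEntangled_le {m : ℕ} {Y : Matrix (Fin m × Fin m) (Fin m × Fin m) ℂ}
    (hY : Y ∈ rainsSet (Fin m) (Fin m)) : hsInner (maxEntangled m) Y ≤ 1 / m := by
  have hswap : (swapMatrix (Fin m) * partialTranspose Y).trace.re ≤ 1 :=
    (re_trace_mul_le_traceNorm (swapMatrix_mem_Icc _).1 (swapMatrix_mem_Icc _).2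
      (isHermitian_partialTranspose hY.1.1)).trans hY.2
  rw [hsInner_of_isHermitian (posSemidef_maxEntangled m).1,
    ← trace_partialTranspose_mul_partialTranspose, partialTranspose_maxEntangled, Matrix.smul_mul,
    Matrix.trace_smul, Complex.real_smul, Complex.re_ofReal_mul, one_div]
  exact mul_le_of_le_one_right (by positivity) hswap

/-- The state proportional to `1 - Ψ_m`, whose mixtures with `Ψ_m` are the isotropic states.
For `m ≤ 1` it is the zero matrix. -/
noncomputable def orthogonalIsotropic (m : ℕ) : Matrix (Fin m × Fin m) (Fin m × Fin m) ℂ :=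
  ((m : ℝ) ^ 2 - 1)⁻¹ • (1 - maxEntangled m)

theorem isState_orthogonalIsotropic {m : ℕ} (hm : 1 < m) : IsState (orthogonalIsotropic m) := by
  have hD : (0 : ℝ) < (m : ℝ) ^ 2 - 1 := sub_pos.2 (one_lt_pow₀ (Nat.one_lt_cast.2 hm) two_ne_zero)
  have hD' : (m : ℂ) * m - 1 ≠ 0 := by rw [← sq]; exact_mod_cast hD.ne'
  refine ⟨(isEffect_maxEntangled (by omega)).2.smul (inv_pos.2 hD).le, ?_⟩
  rw [orthogonalIsotropic, Matrix.trace_smul, Matrix.trace_sub, trace_maxEntangled (by omega)]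
  simp [sq, hD']

theorem partialTranspose_isotropic (m : ℕ) (w u : ℝ) :
    partialTranspose (w • maxEntangled m + u • orthogonalIsotropic m) =
      (u / (m ^ 2 - 1)) • (1 : Matrix (Fin m × Fin m) (Fin m × Fin m) ℂ) +
        (w / m - u / ((m ^ 2 - 1) * m)) • swapMatrix (Fin m) := by
  have hPT := isLinearMap_partialTranspose (A := Fin m) (B := Fin m)
  rw [orthogonalIsotropic, hPT.map_add, hPT.map_smul, hPT.map_smul, hPT.map_smul, hPT.map_sub,
    partialTranspose_one, partialTranspose_maxEntangled, div_eq_mul_inv, div_eq_mul_inv,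
    div_eq_mul_inv, mul_inv]
  module

theorem isotropic_mem_rainsSet {m : ℕ} (hm : 1 < m) {w u : ℝ} (hw : 0 ≤ w) (hu : 0 ≤ u)
    (hmw : m * w ≤ 1) (hwu : w + u ≤ 1) :
    w • maxEntangled m + u • orthogonalIsotropic m ∈ rainsSet (Fin m) (Fin m) := by
  have hm' : (1 : ℝ) < m := Nat.one_lt_cast.2 hm
  have hD : (m : ℝ) ^ 2 - 1 = (m - 1) * (m + 1) := by ring
  have hpred : (0 : ℝ) < m - 1 := sub_pos.2 hm'
  refine ⟨((posSemidef_maxEntangled m).smul hw).add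
    ((isState_orthogonalIsotropic hm).1.smul hu), ?_⟩
  have hbound := traceNorm_smul_one_add_smul_swapMatrix_le (Fin m) (u / (m ^ 2 - 1))
    (w / m - u / ((m ^ 2 - 1) * m))
  have hplus : u / ((m : ℝ) ^ 2 - 1) + (w / m - u / ((m ^ 2 - 1) * m)) =
      w / m + u / (m * (m + 1)) := by rw [hD]; field_simp; ring
  have hminus : u / ((m : ℝ) ^ 2 - 1) - (w / m - u / ((m ^ 2 - 1) * m)) =
      u / (m * (m - 1)) - w / m := by rw [hD]; field_simp; ring
  rw [Fintype.card_fin, hplus, hminus, abs_of_nonneg (by positivity)] at hbound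
  rw [partialTranspose_isotropic]
  refine hbound.trans ?_
  rcases abs_cases (u / ((m : ℝ) * (m - 1)) - w / m) with ⟨habs, -⟩ | ⟨habs, -⟩
  · calc _ = w + u := by rw [habs]; field_simp; ring
      _ ≤ 1 := hwu
  · calc _ = m * w := by rw [habs]; field_simp; ring
      _ ≤ 1 := hmw

theorem mem_rainsSet_of_subsingleton {A B : Type*} [Fintype A] [Fintype B] [DecidableEq A]
    [DecidableEq B] [Subsingleton B] {X : Matrix (A × B) (A × B) ℂ} (hX : X.PosSemidef)
    (htr : X.trace.re ≤ 1) : X ∈ rainsSet A B :=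
  ⟨hX, by rwa [partialTranspose_of_subsingleton, traceNorm_of_posSemidef hX]⟩

theorem exists_isState_isotropic_mem_rainsSet {m : ℕ} (hm : 0 < m) :
    ∃ Q, IsState Q ∧ ∀ w u : ℝ, 0 ≤ w → 0 ≤ u → m * w ≤ 1 → w + u ≤ 1 →
      w • maxEntangled m + u • Q ∈ rainsSet (Fin m) (Fin m) := by
  obtain rfl | hm' : m = 1 ∨ 1 < m := by omega
  · -- `Ψ_1` has no complement to prepare, but every state on `ℂ ⊗ ℂ` lies in the Rains set.
    have hΨ := isState_maxEntangled hm
    refine ⟨maxEntangled 1, hΨ, fun w u hw hu _ hwu => mem_rainsSet_of_subsingleton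
      ((hΨ.1.smul hw).add (hΨ.1.smul hu)) ?_⟩
    simpa [hΨ.2] using hwu
  · exact ⟨orthogonalIsotropic m, isState_orthogonalIsotropic hm',
      fun w u hw hu hmw hwu => isotropic_mem_rainsSet hm' hw hu hmw hwu⟩

end MaxEntangled

section Polar

variable {n : Type*} [Fintype n] {Q : Set (Matrix n n ℂ)} {m : ℝ}

theorem mem_one_div_smul_polar (hm : 0 < m) {W : Matrix n n ℂ} (hW : W.IsHermitian) :
    W ∈ (1 / m) • polar Q ↔ ∀ Z ∈ Q, hsInner W Z ≤ 1 / m := by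
  have hmW : ((1 / m)⁻¹ • W).IsHermitian := hW.smul (.all _)
  rw [Set.mem_smul_set_iff_inv_smul_mem₀ (by positivity)]
  simp only [polar, Set.mem_ofPred_eq, hmW, true_and, hsInner_smul_left]
  refine forall₂_congr fun Z _ => ?_
  rw [one_div, inv_inv, ← one_div, le_div_iff₀' hm]

variable [DecidableEq n]

theorem mem_gValues_iff (hm : 0 < m) {ρ : Matrix n n ℂ} {g : ℝ} :
    g ∈ gValues Q m ρ ↔ ∃ W, IsEffect W ∧ (∀ Z ∈ Q, hsInner W Z ≤ 1 / m) ∧ g = hsInner ρ W :=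
  exists_congr fun _ => and_congr_right fun hW =>
    and_congr_left fun _ => mem_one_div_smul_polar hm hW.1.1

theorem isGreatest_gQuantity (hm : 0 < m) (Q : Set (Matrix n n ℂ)) (ρ : Matrix n n ℂ) :
    IsGreatest (gValues Q m ρ) (gQuantity Q m ρ) := by
  let K : Set (Matrix n n ℂ) := {W | IsEffect W} ∩ ⋂ Z ∈ Q, {W | hsInner Z W ≤ 1 / m}
  have hK : IsCompact K := isCompact_setOf_isEffect.inter_right
    (isClosed_biInter fun Z _ => isClosed_le (continuous_hsInner Z) continuous_const)
  have hzero : (0 : Matrix n n ℂ) ∈ K := by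
    refine ⟨isEffect_zero, Set.mem_iInter₂.2 fun Z _ => ?_⟩
    rw [Set.mem_ofPred_eq, (isLinearMap_hsInner Z).map_zero]
    positivity
  have himage : gValues Q m ρ = hsInner ρ '' K := by
    ext g
    simp only [mem_gValues_iff hm, hsInner_comm _ (_ : Matrix n n ℂ), K, Set.mem_image,
      Set.mem_inter_iff, Set.mem_iInter, Set.mem_ofPred_eq, and_assoc, eq_comm (a := g)]
  rw [gQuantity, himage]
  exact (hK.image (continuous_hsInner ρ)).isGreatest_sSup (Set.Nonempty.image _ ⟨0, hzero⟩)

end Polar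

section Minimax

variable {n : Type*} [Fintype n]

theorem exists_isSaddlePointOn_hsInner {T Q : Set (Matrix n n ℂ)} (hT : T.Nonempty)
    (hTconv : Convex ℝ T) (hTcomp : IsCompact T) (hQ : Q.Nonempty) (hQconv : Convex ℝ Q)
    (hQcomp : IsCompact Q) : ∃ M ∈ T, ∃ X ∈ Q, IsSaddlePointOn T Q hsInner M X := by
  refine Sion.exists_isSaddlePointOn hT hTconv hTcomp (fun X _ => ?_) (fun X _ => ?_)
    hQconv hQ hQcomp
    (fun M _ => (continuous_hsInner M).upperSemicontinuous.upperSemicontinuousOn _)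
    (fun M _ => (((isLinearMap_hsInner M).mk' _).concaveOn hQconv).quasiconcaveOn)
  · simpa only [hsInner_comm _ X] using
      (continuous_hsInner X).lowerSemicontinuous.lowerSemicontinuousOn _
  · simp only [hsInner_comm _ X]
    exact (((isLinearMap_hsInner X).mk' _).convexOn hTconv).quasiconvexOn

variable [DecidableEq n]

/-- The tests `M` accepting `ρ` up to an error `ε`, over which `D_H^ε(ρ‖·)` is optimized. -/
def feasibleTests (ε : ℝ) (ρ : Matrix n n ℂ) : Set (Matrix n n ℂ) :=
  {M | IsEffect M ∧ 1 - hsInner M ρ ≤ ε}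

variable {ε : ℝ} {ρ : Matrix n n ℂ}

theorem feasibleTests_eq_inter :
    feasibleTests ε ρ = {M | IsEffect M} ∩ {M | 1 - ε ≤ hsInner ρ M} := by
  ext M
  simp only [feasibleTests, Set.mem_inter_iff, Set.mem_ofPred_eq, hsInner_comm M ρ, sub_le_comm]

theorem convex_feasibleTests : Convex ℝ (feasibleTests ε ρ) :=
  feasibleTests_eq_inter (ρ := ρ) ▸
    convex_setOf_isEffect.inter (convex_halfSpace_ge (isLinearMap_hsInner ρ) _)

theorem isCompact_feasibleTests : IsCompact (feasibleTests ε ρ) :=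
  feasibleTests_eq_inter (ρ := ρ) ▸
    isCompact_setOf_isEffect.inter_right (isClosed_le continuous_const (continuous_hsInner ρ))

theorem one_mem_feasibleTests (hε : 1 - ε ≤ ρ.trace.re) : 1 ∈ feasibleTests ε ρ :=
  ⟨isEffect_one, by rw [hsInner_one_left]; exact sub_le_comm.1 hε⟩

theorem elog2_mono : Monotone elog2 := by
  intro x y hxy
  unfold elog2
  split_ifs with hx hy hy
  · exact le_rfl
  · exact bot_le
  · exact absurd (hxy.trans hy) hx
  · exact EReal.coe_le_coe (Real.logb_le_logb_of_le one_lt_two (not_le.1 hx) hxy)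

theorem elog2_of_pos {x : ℝ} (hx : 0 < x) : elog2 x = (Real.logb 2 x : ℝ) :=
  if_neg (not_le.2 hx)

theorem hypothesisTestingEntropy_eq (X : Matrix n n ℂ) :
    hypothesisTestingEntropy ε ρ X = -elog2 (sInf (hsInner X '' feasibleTests ε ρ)) := by
  have himage : {t | ∃ M, IsEffect M ∧ 1 - hsInner M ρ ≤ ε ∧ t = hsInner M X} =
      hsInner X '' feasibleTests ε ρ := by
    ext t
    simp only [feasibleTests, Set.mem_image, Set.mem_ofPred_eq, and_assoc, eq_comm (a := t),
      hsInner_comm _ X]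
  rw [hypothesisTestingEntropy, himage]

variable {Q : Set (Matrix n n ℂ)} {M₀ X₀ : Matrix n n ℂ}

theorem isLeast_hypothesisTestingEntropy_image (hQ : ∀ X ∈ Q, X.PosSemidef)
    (hM₀ : M₀ ∈ feasibleTests ε ρ) (hX₀ : X₀ ∈ Q)
    (hsaddle : IsSaddlePointOn (feasibleTests ε ρ) Q hsInner M₀ X₀) (hpos : 0 < hsInner M₀ X₀) :
    IsLeast (hypothesisTestingEntropy ε ρ '' Q) (-Real.logb 2 (hsInner M₀ X₀) : ℝ) := by
  have hoptimal : IsLeast (hsInner X₀ '' feasibleTests ε ρ) (hsInner M₀ X₀) := by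
    refine ⟨⟨M₀, hM₀, hsInner_comm _ _⟩, Set.forall_mem_image.2 fun M hM => ?_⟩
    exact (hsaddle M hM X₀ hX₀).trans_eq (hsInner_comm _ _)
  rw [EReal.coe_neg, ← elog2_of_pos hpos]
  refine ⟨⟨X₀, hX₀, by rw [hypothesisTestingEntropy_eq, hoptimal.csInf_eq]⟩,
    Set.forall_mem_image.2 fun X hX => ?_⟩
  have hbdd : BddBelow (hsInner X '' feasibleTests ε ρ) :=
    ⟨0, Set.forall_mem_image.2 fun M hM => hsInner_nonneg (hQ X hX) hM.1.1⟩
  rw [hypothesisTestingEntropy_eq, EReal.neg_le_neg_iff]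
  refine elog2_mono ((csInf_le hbdd ⟨M₀, hM₀, rfl⟩).trans ?_)
  exact (hsInner_comm _ _).trans_le (hsaddle M₀ hM₀ X hX)

theorem le_gQuantity_iff_of_isSaddlePointOn (hM₀ : M₀ ∈ feasibleTests ε ρ) (hX₀ : X₀ ∈ Q)
    (hsaddle : IsSaddlePointOn (feasibleTests ε ρ) Q hsInner M₀ X₀) {m : ℝ} (hm : 0 < m) :
    1 - ε ≤ gQuantity Q m ρ ↔ m * hsInner M₀ X₀ ≤ 1 := by
  have hgreatest := isGreatest_gQuantity hm Q ρ
  rw [← le_div_iff₀' hm]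
  constructor
  · intro hle
    obtain ⟨W, hW, hWQ, hWρ⟩ := (mem_gValues_iff hm).1 hgreatest.1
    have hWtest : W ∈ feasibleTests ε ρ := ⟨hW, by rw [hsInner_comm, ← hWρ]; linarith⟩
    exact (hsaddle W hWtest X₀ hX₀).trans (hWQ X₀ hX₀)
  · intro hle
    have hM₀ρ : hsInner ρ M₀ ∈ gValues Q m ρ :=
      (mem_gValues_iff hm).2 ⟨M₀, hM₀.1, fun Z hZ => (hsaddle M₀ hM₀ Z hZ).trans hle, rfl⟩
    calc 1 - ε ≤ hsInner ρ M₀ := by rw [hsInner_comm]; exact sub_le_comm.1 hM₀.2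
      _ ≤ gQuantity Q m ρ := hgreatest.2 hM₀ρ

theorem hsInner_pos_of_isSaddlePointOn (hε : ε < 1) (hM₀ : M₀ ∈ feasibleTests ε ρ)
    (hsaddle : IsSaddlePointOn (feasibleTests ε ρ) Q hsInner M₀ X₀) {c : ℝ} (hc : 0 < c)
    (hcρ : c • ρ ∈ Q) : 0 < hsInner M₀ X₀ :=
  calc 0 < c * hsInner M₀ ρ := mul_pos hc (by linarith [hM₀.2])
    _ = hsInner M₀ (c • ρ) := ((isLinearMap_hsInner M₀).map_smul c ρ).symm
    _ ≤ hsInner M₀ X₀ := hsaddle M₀ hM₀ _ hcρ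

end Minimax

section Distillation

variable {A B : Type*} [Fintype A] [Fintype B] [DecidableEq A] [DecidableEq B]
  {ρ : Matrix (A × B) (A × B) ℂ} {m : ℕ}

theorem achievableFidelities_subset_gValues (hm : 0 < m) :
    achievableFidelities ρ m ⊆ gValues (rainsSet A B) m ρ := by
  rintro _ ⟨Λ, ⟨⟨hcp, htr⟩, hΛ⟩, rfl⟩
  have hpos (X : Matrix (A × B) (A × B) ℂ) (hX : X.PosSemidef) := hcp.posSemidef_apply hX
  have hΨ := isEffect_maxEntangled hm
  have hadj := hsInner_traceAdjoint hpos htr hΨ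
  refine (mem_gValues_iff (Nat.cast_pos.2 hm)).2
    ⟨traceAdjoint Λ (maxEntangled m), isEffect_traceAdjoint hpos htr hΨ, fun Z hZ => ?_, ?_⟩
  · rw [hadj]
    exact hsInner_maxEntangled_le (hΛ Z hZ)
  · rw [hsInner_comm, ← hadj, hsInner_comm]

theorem measurePrepare_mem_rainsPreserving {W : Matrix (A × B) (A × B) ℂ} (hW : IsEffect W)
    (hWm : ∀ Z ∈ rainsSet A B, m * hsInner W Z ≤ 1)
    {P Q : Matrix (Fin m × Fin m) (Fin m × Fin m) ℂ} (hP : IsState P) (hQ : IsState Q)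
    (hPQ : ∀ w u : ℝ, 0 ≤ w → 0 ≤ u → m * w ≤ 1 → w + u ≤ 1 →
      w • P + u • Q ∈ rainsSet (Fin m) (Fin m)) :
    measurePrepare W P Q ∈ rainsPreserving A B (Fin m) (Fin m) := by
  refine ⟨isCPTP_measurePrepare hW hP hQ, fun X hX => ?_⟩
  rw [measurePrepare_apply_of_posSemidef hW hX.1]
  refine hPQ _ _ (hsInner_nonneg hW.1 hX.1) (hsInner_nonneg hW.2 hX.1) (hWm X hX) ?_
  rw [hsInner_sub_left, hsInner_one_left, add_sub_cancel]
  exact re_trace_le_one_of_mem_rainsSet hX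

theorem exists_achievableFidelities_ge (hρ : ρ.PosSemidef) (hm : 0 < m) {g : ℝ}
    (hg : g ∈ gValues (rainsSet A B) m ρ) : ∃ f ∈ achievableFidelities ρ m, g ≤ f := by
  have hm' : (0 : ℝ) < m := Nat.cast_pos.2 hm
  obtain ⟨W, hW, hWm, rfl⟩ := (mem_gValues_iff hm').1 hg
  obtain ⟨Q, hQ, hmix⟩ := exists_isState_isotropic_mem_rainsSet hm
  have hΛ := measurePrepare_mem_rainsPreserving hW
    (fun Z hZ => (le_div_iff₀' hm').1 (hWm Z hZ)) (isState_maxEntangled hm) hQ hmix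
  have hfidelity : hsInner (measurePrepare W (maxEntangled m) Q ρ) (maxEntangled m) =
      hsInner W ρ + hsInner (1 - W) ρ * hsInner (maxEntangled m) Q := by
    have hlin := isLinearMap_hsInner (maxEntangled m)
    rw [measurePrepare_apply_of_posSemidef hW hρ, hsInner_comm, hlin.map_add, hlin.map_smul,
      hlin.map_smul, hsInner_maxEntangled_self hm, smul_eq_mul, smul_eq_mul, mul_one]
  refine ⟨_, ⟨_, hΛ, rfl⟩, ?_⟩
  rw [hfidelity, hsInner_comm]
  exact le_add_of_nonneg_right
    (mul_nonneg (hsInner_nonneg hW.2 hρ) (hsInner_nonneg (posSemidef_maxEntangled m) hQ.1))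

theorem isLUB_achievableFidelities (hρ : ρ.PosSemidef) (hm : 0 < m) :
    IsLUB (achievableFidelities ρ m) (gQuantity (rainsSet A B) m ρ) := by
  have hG := isGreatest_gQuantity (Nat.cast_pos.2 hm) (rainsSet A B) ρ
  refine ⟨fun f hf => hG.2 (achievableFidelities_subset_gValues hm hf), fun b hb => ?_⟩
  obtain ⟨f, hf, hgf⟩ := exists_achievableFidelities_ge hρ hm hG.1
  exact hgf.trans (hb hf)

theorem distillationFidelity_eq_gQuantity (hρ : ρ.PosSemidef) (hm : 0 < m) :
    distillationFidelity ρ m = gQuantity (rainsSet A B) m ρ := by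
  have hG := isGreatest_gQuantity (Nat.cast_pos.2 hm) (rainsSet A B) ρ
  obtain ⟨f, hf, -⟩ := exists_achievableFidelities_ge hρ hm hG.1
  exact (isLUB_achievableFidelities hρ hm).csSup_eq ⟨f, hf⟩

theorem exists_minimax_value (hρ : ρ.PosSemidef) {ε : ℝ} (hρε : 1 - ε ≤ ρ.trace.re) (hε : ε < 1) :
    ∃ v : ℝ, 0 < v ∧ v ≤ 1 ∧
      IsLeast (hypothesisTestingEntropy ε ρ '' rainsSet A B) (-Real.logb 2 v : ℝ) ∧
      distillableSizes ρ ε = {m : ℕ | 0 < m ∧ m * v ≤ 1} := by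
  obtain ⟨M₀, hM₀, X₀, hX₀, hsaddle⟩ := exists_isSaddlePointOn_hsInner
    ⟨1, one_mem_feasibleTests hρε⟩ convex_feasibleTests isCompact_feasibleTests
    ⟨0, zero_mem_rainsSet⟩ convex_rainsSet (isCompact_rainsSet (A := A) (B := B))
  obtain ⟨c, hc, hcρ⟩ := exists_pos_smul_mem_rainsSet hρ
  have hpos := hsInner_pos_of_isSaddlePointOn hε hM₀ hsaddle hc hcρ
  refine ⟨hsInner M₀ X₀, hpos, ?_, ?_, ?_⟩
  · exact (hM₀.1.hsInner_le_re_trace hX₀.1).trans (re_trace_le_one_of_mem_rainsSet hX₀)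
  · exact isLeast_hypothesisTestingEntropy_image (fun X hX => hX.1) hM₀ hX₀ hsaddle hpos
  · refine Set.ext fun m => and_congr_right fun hm => ?_
    rw [distillationFidelity_eq_gQuantity hρ hm]
    exact le_gQuantity_iff_of_isSaddlePointOn hM₀ hX₀ hsaddle (Nat.cast_pos.2 hm)

theorem isGreatest_floor_inv {v : ℝ} (hv : 0 < v) (hv' : v ≤ 1) :
    IsGreatest {m : ℕ | 0 < m ∧ m * v ≤ 1} ⌊v⁻¹⌋₊ := by
  simp only [← le_div_iff₀ hv, one_div]
  exact ⟨⟨Nat.floor_pos.2 ((one_le_inv₀ hv).2 hv'), Nat.floor_le (inv_pos.2 hv).le⟩,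
    fun m hm => Nat.le_floor hm.2⟩

theorem logFloor_neg_logb {v : ℝ} (hv : 0 < v) :
    logFloor (-Real.logb 2 v) = Real.logb 2 ⌊v⁻¹⌋₊ := by
  rw [logFloor, ← Real.logb_inv, Real.rpow_logb two_pos (by norm_num) (inv_pos.2 hv),
    natCast_floor_eq_intCast_floor (inv_pos.2 hv).le]

end Distillation

end RainsDistillation


theorem mainTheorem7_general {A B : Type*} [Fintype A] [Fintype B] [DecidableEq A] [DecidableEq B]
    (ρ : Matrix (A × B) (A × B) ℂ) (hρ : ρ.PosSemidef) :
    (∀ m : ℕ, 0 < m →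
      IsLUB (achievableFidelities ρ m) (distillationFidelity ρ m) ∧
      IsLUB (gValues (rainsSet A B) m ρ) (gQuantity (rainsSet A B) m ρ) ∧
      distillationFidelity ρ m = gQuantity (rainsSet A B) m ρ) ∧
    (∀ ε : ℝ, 1 - ε ≤ ρ.trace.re → ε < 1 →
      IsGreatest (distillableSizes ρ ε) (sSup (distillableSizes ρ ε)) ∧
      ∃ d : ℝ,
        IsLeast ((fun X => hypothesisTestingEntropy ε ρ X) '' rainsSet A B) (d : EReal) ∧
        oneShotDistillable ρ ε = logFloor d) := by
  refine ⟨fun m hm => ?_, fun ε hρε hε => ?_⟩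
  · have hF := distillationFidelity_eq_gQuantity hρ hm
    exact ⟨hF ▸ isLUB_achievableFidelities hρ hm,
      (isGreatest_gQuantity (Nat.cast_pos.2 hm) _ ρ).isLUB, hF⟩
  · obtain ⟨v, hv, hv', hleast, hsizes⟩ := exists_minimax_value hρ hρε hε
    have hgreatest : IsGreatest (distillableSizes ρ ε) ⌊v⁻¹⌋₊ :=
      hsizes ▸ isGreatest_floor_inv hv hv'
    refine ⟨hgreatest.csSup_eq.symm ▸ hgreatest, -Real.logb 2 v, hleast, ?_⟩
    rw [oneShotDistillable, hgreatest.csSup_eq, logFloor_neg_logb hv]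

theorem mainTheorem7 {A B : Type*} [Fintype A] [Fintype B] [DecidableEq A] [DecidableEq B]
    (ρ : Matrix (A × B) (A × B) ℂ) (hρ : IsState ρ) :
    (∀ m : ℕ, 0 < m →
      IsLUB (achievableFidelities ρ m) (distillationFidelity ρ m) ∧
      IsLUB (gValues (rainsSet A B) m ρ) (gQuantity (rainsSet A B) m ρ) ∧
      distillationFidelity ρ m = gQuantity (rainsSet A B) m ρ) ∧
    (∀ ε : ℝ, 0 ≤ ε → ε < 1 →
      IsGreatest (distillableSizes ρ ε) (sSup (distillableSizes ρ ε)) ∧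
      ∃ d : ℝ,
        IsLeast ((fun X => hypothesisTestingEntropy ε ρ X) '' rainsSet A B) (d : EReal) ∧
        oneShotDistillable ρ ε = logFloor d) := by
  obtain ⟨hfidelity, honeShot⟩ := mainTheorem7_general ρ hρ.1
  exact ⟨hfidelity, fun ε hε => honeShot ε (by simpa [hρ.2] using hε)⟩
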